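/- Let $d\ge 1$ and let $\Omega\subset\mathbb{R}^d$ be an open set of finite Lebesgue measure $|\Omega|$; no regularity of $\partial\Omega$ is assumed. Identify $L^2(\Omega)$ with the (complex-valued) functions in $L^2(\mathbb{R}^d)$ that vanish outside $\Omega$, and write $\widehat u(\xi)=\int_{\mathbb{R}^d}e^{-ix\cdot\xi}u(x)\,dx$. Let $\mathbb{H}(\Omega)\subset L^2(\Omega)$ be the closure of $C_c^\infty(\Omega)$ with respect to the norm given by $\|u\|_*^2=\int_{\mathbb{R}^d}\log(e+|\xi|)\,|\widehat u(\xi)|^2\,d\xi$, and for $u,v\in\mathbb{H}(\Omega)$ put $$(u,v)_{\log}=\frac1{(2\pi)^d}\int_{\mathbb{R}^d}\log|\xi|\;\widehat u(\xi)\,\overline{\widehat v(\xi)}\,d\xi .$$ A real number $\mu$ is a Dirichlet eigenvalue of $\mathcal{H}=\tfrac12\log(-\Delta)$ on $\Omega$ if the space of all $u\in\mathbb{H}(\Omega)$ with $(u,v)_{\log}=\mu\int_\Omega u\,\overline{v}\,dx$ for every $v\in\mathbb{H}(\Omega)$ is nonzero; the dimension of this space is the multiplicity of $\mu$. Let $\lambda_k$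 denote these eigenvalues, each repeated according to its multiplicity. Then for every $\lambda\in\mathbb{R}$ $$\sum_k(\lambda-\lambda_k)_+\;\le\;\frac{1}{(2\pi)^d}\,|\Omega|\,e^{d\lambda}\,|B_d|\,d^{-1},$$ where $t_+=\max(t,0)$ and $|B_d|$ is the measure of the unit ball in $\mathbb{R}^d$. -/

import Mathlib

open MeasureTheory
open scoped ENNReal ComplexConjugate

namespace LogLaplacian

noncomputable section

/-- The Euclidean space `ℝ^d`. -/
abbrev Space (d : ℕ) := EuclideanSpace ℝ (Fin d)

/-- The complex Hilbert space `L²(Ω)`. Its elements are thought of as extended by zero to `ℝ^d`. -/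
abbrev L2 {d : ℕ} (Ω : Set (Space d)) := Lp ℂ 2 ((volume : Measure (Space d)).restrict Ω)

/-- The Fourier transform `û(ξ) = ∫ e^{-i x·ξ} u(x) dx` of the extension by zero of `u ∈ L²(Ω)`.
The integral converges absolutely when `Ω` has finite measure, as then `L²(Ω) ⊆ L¹(Ω)`. -/
def fourierTr {d : ℕ} (Ω : Set (Space d)) (u : L2 Ω) (ξ : Space d) : ℂ :=
  ∫ x in Ω, Complex.exp (-(Complex.I * ((inner ℝ x ξ : ℝ) : ℂ))) * u x

/-- The squared norm `‖u‖_*² = ∫ log (e + |ξ|) |û(ξ)|² dξ`, with values in `[0, ∞]`. -/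
def starNormSq {d : ℕ} (Ω : Set (Space d)) (u : L2 Ω) : ℝ≥0∞ :=
  ∫⁻ ξ : Space d, ENNReal.ofReal (Real.log (Real.exp 1 + ‖ξ‖)) * ‖fourierTr Ω u ξ‖ₑ ^ 2

/-- `u ∈ L²(Ω)` is (the class of) a test function `φ ∈ C_c^∞(Ω)`. -/
def IsTestFunction {d : ℕ} (Ω : Set (Space d)) (u : L2 Ω) : Prop :=
  ∃ φ : Space d → ℂ, ContDiff ℝ ((⊤ : ℕ∞) : WithTop ℕ∞) φ ∧ HasCompactSupport φ ∧ tsupport φ ⊆ Ω ∧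
    u =ᵐ[volume.restrict Ω] φ

/-- Membership in `ℍ(Ω)`, the closure of `C_c^∞(Ω)` with respect to the norm `‖·‖_*`
(among the elements of `L²(Ω)` for which that norm is finite). -/
def MemFormDomain {d : ℕ} (Ω : Set (Space d)) (u : L2 Ω) : Prop :=
  starNormSq Ω u < ⊤ ∧
    ∀ ε : ℝ≥0∞, 0 < ε → ∃ φ : L2 Ω, IsTestFunction Ω φ ∧ starNormSq Ω (u - φ) < ε

/-- The sesquilinear form `(u, v)_log = (2π)^{-d} ∫ log |ξ| û(ξ) conj (v̂(ξ)) dξ`. -/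
def logForm {d : ℕ} (Ω : Set (Space d)) (u v : L2 Ω) : ℂ :=
  (((2 * Real.pi) ^ d)⁻¹ : ℝ) *
    ∫ ξ : Space d, (Real.log ‖ξ‖ : ℂ) * (fourierTr Ω u ξ * conj (fourierTr Ω v ξ))

/-- `u` is a weak solution of `𝓗 u = μ u` in `Ω`, `u = 0` on `ℝ^d ∖ Ω`, where `𝓗 = ½ log (-Δ)`:
`u ∈ ℍ(Ω)` and `(u, v)_log = μ ∫_Ω u conj(v)` for all `v ∈ ℍ(Ω)`. -/
def IsWeakSolution {d : ℕ} (Ω : Set (Space d)) (μ : ℝ) (u : L2 Ω) : Prop :=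
  MemFormDomain Ω u ∧
    ∀ v : L2 Ω, MemFormDomain Ω v →
      logForm Ω u v = (μ : ℂ) * ∫ x in Ω, u x * conj (v x)

section helpers

variable {d : ℕ} {Ω : Set (Space d)}

theorem norm_kernel (x ξ : Space d) :
    ‖Complex.exp (-(Complex.I * ((inner ℝ x ξ : ℝ) : ℂ)))‖ = 1 := by
  rw [Complex.norm_exp]; simp

theorem integrable_coe (hΩ : volume Ω ≠ ⊤) (u : L2 Ω) :
    Integrable (fun x => u x) (volume.restrict Ω) := by
  have : IsFiniteMeasure (volume.restrict Ω) := ⟨by simpa using hΩ.lt_top⟩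
  exact (Lp.memLp u).integrable (by norm_num)

theorem integrable_kernel_mul (hΩ : volume Ω ≠ ⊤) (u : L2 Ω) (ξ : Space d) :
    Integrable (fun x => Complex.exp (-(Complex.I * ((inner ℝ x ξ : ℝ) : ℂ))) * u x)
      (volume.restrict Ω) := by
  refine (integrable_coe hΩ u).bdd_mul (c := 1) ?_ ?_
  · exact (by fun_prop : Continuous fun x : Space d =>
      Complex.exp (-(Complex.I * ((inner ℝ x ξ : ℝ) : ℂ)))).aestronglyMeasurable
  · exact Filter.Eventually.of_forall fun x => (norm_kernel x ξ).le

theorem fourier_add (hΩ : volume Ω ≠ ⊤) (u v : L2 Ω) (ξ : Space d) :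
    fourierTr Ω (u + v) ξ = fourierTr Ω u ξ + fourierTr Ω v ξ := by
  unfold fourierTr
  rw [← integral_add (integrable_kernel_mul hΩ u ξ) (integrable_kernel_mul hΩ v ξ)]
  refine integral_congr_ae ?_
  filter_upwards [Lp.coeFn_add u v] with x hx
  rw [hx, Pi.add_apply, mul_add]

theorem fourier_smul (c : ℂ) (u : L2 Ω) (ξ : Space d) :
    fourierTr Ω (c • u) ξ = c * fourierTr Ω u ξ := by
  unfold fourierTr
  rw [← integral_const_mul]
  refine integral_congr_ae ?_
  filter_upwards [Lp.coeFn_smul c u] with x hx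
  rw [hx, Pi.smul_apply, smul_eq_mul]
  ring

theorem continuous_fourier (hΩ : volume Ω ≠ ⊤) (u : L2 Ω) : Continuous (fourierTr Ω u) := by
  unfold fourierTr
  refine continuous_of_dominated (bound := fun x => ‖u x‖)
    (fun ξ => (integrable_kernel_mul hΩ u ξ).aestronglyMeasurable) ?_
    (integrable_coe hΩ u).norm ?_
  · intro ξ
    refine Filter.Eventually.of_forall fun x => ?_
    rw [norm_mul, norm_kernel, one_mul]
  · refine Filter.Eventually.of_forall fun x => ?_
    fun_prop

theorem norm_fourier_le (u : L2 Ω) (ξ : Space d) :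
    ‖fourierTr Ω u ξ‖ ≤ ∫ x in Ω, ‖u x‖ := by
  refine (norm_integral_le_integral_norm _).trans (le_of_eq ?_)
  refine integral_congr_ae (Filter.Eventually.of_forall fun x => ?_)
  simp only [norm_mul, norm_kernel, one_mul]

theorem one_le_weight (ξ : Space d) : 1 ≤ Real.log (Real.exp 1 + ‖ξ‖) := by
  have h := Real.log_le_log (Real.exp_pos 1) (le_add_of_nonneg_right (norm_nonneg ξ))
  rwa [Real.log_exp] at h

theorem continuous_weight : Continuous fun ξ : Space d => Real.log (Real.exp 1 + ‖ξ‖) := by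
  refine Continuous.log (by fun_prop) fun ξ => ?_
  positivity

theorem starNormSq_add_le (hΩ : volume Ω ≠ ⊤) (u v : L2 Ω) :
    starNormSq Ω (u + v) ≤ 2 * starNormSq Ω u + 2 * starNormSq Ω v := by
  have hm : ∀ w : L2 Ω, Measurable fun ξ : Space d =>
      ENNReal.ofReal (Real.log (Real.exp 1 + ‖ξ‖)) * ‖fourierTr Ω w ξ‖ₑ ^ 2 := fun w =>
    (continuous_weight.measurable.ennreal_ofReal).mul
      ((continuous_fourier hΩ w).measurable.enorm.pow_const 2)
  unfold starNormSq
  rw [← lintegral_const_mul _ (hm u), ← lintegral_const_mul _ (hm v),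
    ← lintegral_add_left ((hm u).const_mul 2)]
  refine lintegral_mono fun ξ => ?_
  have h : ‖fourierTr Ω (u + v) ξ‖ₑ ^ 2 ≤ 2 * ‖fourierTr Ω u ξ‖ₑ ^ 2 + 2 * ‖fourierTr Ω v ξ‖ₑ ^ 2 := by
    rw [fourier_add hΩ]
    have h1 : ‖fourierTr Ω u ξ + fourierTr Ω v ξ‖₊ ^ 2
        ≤ 2 * ‖fourierTr Ω u ξ‖₊ ^ 2 + 2 * ‖fourierTr Ω v ξ‖₊ ^ 2 := by
      rw [← NNReal.coe_le_coe]
      push_cast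
      nlinarith [norm_add_le (fourierTr Ω u ξ) (fourierTr Ω v ξ),
        norm_nonneg (fourierTr Ω u ξ + fourierTr Ω v ξ),
        sq_nonneg (‖fourierTr Ω u ξ‖ - ‖fourierTr Ω v ξ‖),
        norm_nonneg (fourierTr Ω u ξ), norm_nonneg (fourierTr Ω v ξ)]
    simp only [enorm_eq_nnnorm]
    exact_mod_cast h1
  calc _ ≤ ENNReal.ofReal (Real.log (Real.exp 1 + ‖ξ‖)) *
        (2 * ‖fourierTr Ω u ξ‖ₑ ^ 2 + 2 * ‖fourierTr Ω v ξ‖ₑ ^ 2) := by gcongr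
    _ = _ := by ring

theorem starNormSq_smul (hΩ : volume Ω ≠ ⊤) (c : ℂ) (u : L2 Ω) :
    starNormSq Ω (c • u) = ‖c‖ₑ ^ 2 * starNormSq Ω u := by
  have hm : Measurable fun ξ : Space d =>
      ENNReal.ofReal (Real.log (Real.exp 1 + ‖ξ‖)) * ‖fourierTr Ω u ξ‖ₑ ^ 2 :=
    (continuous_weight.measurable.ennreal_ofReal).mul
      ((continuous_fourier hΩ u).measurable.enorm.pow_const 2)
  unfold starNormSq
  rw [← lintegral_const_mul _ hm]
  refine lintegral_congr fun ξ => ?_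
  rw [fourier_smul, enorm_mul]
  ring

theorem isTestFunction_zero : IsTestFunction Ω (0 : L2 Ω) :=
  ⟨0, contDiff_const, HasCompactSupport.zero, by simp [tsupport], Lp.coeFn_zero _ _ _⟩

theorem IsTestFunction.add {u v : L2 Ω} (hu : IsTestFunction Ω u) (hv : IsTestFunction Ω v) :
    IsTestFunction Ω (u + v) := by
  obtain ⟨f, hf, hfc, hfs, hfu⟩ := hu
  obtain ⟨g, hg, hgc, hgs, hgv⟩ := hv
  refine ⟨f + g, hf.add hg, hfc.add hgc,
    (tsupport_add f g).trans (Set.union_subset hfs hgs), ?_⟩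
  filter_upwards [Lp.coeFn_add u v, hfu, hgv] with x hx h1 h2
  rw [hx, Pi.add_apply, Pi.add_apply, h1, h2]

theorem IsTestFunction.smul (c : ℂ) {u : L2 Ω} (hu : IsTestFunction Ω u) :
    IsTestFunction Ω (c • u) := by
  obtain ⟨f, hf, hfc, hfs, hfu⟩ := hu
  refine ⟨fun x => c • f x, hf.const_smul c, hfc.smul_left (f := fun _ => c),
    (tsupport_smul_subset_right (fun _ => c) f).trans hfs, ?_⟩
  filter_upwards [Lp.coeFn_smul c u, hfu] with x hx h1
  rw [hx, Pi.smul_apply, h1]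

theorem starNormSq_zero : starNormSq Ω (0 : L2 Ω) = 0 := by
  have h : ∀ ξ, fourierTr Ω (0 : L2 Ω) ξ = 0 := fun ξ => by
    have := fourier_smul (0 : ℂ) (0 : L2 Ω) ξ
    simpa using this
  simp [starNormSq, h]

theorem memFormDomain_zero : MemFormDomain Ω (0 : L2 Ω) :=
  ⟨by simp [starNormSq_zero], fun ε hε => ⟨0, isTestFunction_zero, by simpa [starNormSq_zero]⟩⟩

theorem MemFormDomain.add (hΩ : volume Ω ≠ ⊤) {u v : L2 Ω} (hu : MemFormDomain Ω u)
    (hv : MemFormDomain Ω v) : MemFormDomain Ω (u + v) := by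
  refine ⟨(starNormSq_add_le hΩ u v).trans_lt ?_, fun ε hε => ?_⟩
  · exact ENNReal.add_lt_top.2 ⟨ENNReal.mul_lt_top (by simp) hu.1, ENNReal.mul_lt_top (by simp) hv.1⟩
  · have h4 : 0 < ε / 4 := ENNReal.div_pos hε.ne' (by simp)
    obtain ⟨f, hf, hfu⟩ := hu.2 _ h4
    obtain ⟨g, hg, hgv⟩ := hv.2 _ h4
    refine ⟨f + g, hf.add hg, ?_⟩
    rw [add_sub_add_comm]
    refine (starNormSq_add_le hΩ _ _).trans_lt ?_
    have h2 : (2 : ℝ≥0∞) ≠ 0 := by simp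
    have h2' : (2 : ℝ≥0∞) ≠ ⊤ := by simp
    calc 2 * starNormSq Ω (u - f) + 2 * starNormSq Ω (v - g)
        < 2 * (ε / 4) + 2 * (ε / 4) :=
          ENNReal.add_lt_add (ENNReal.mul_lt_mul_right h2 h2' hfu)
            (ENNReal.mul_lt_mul_right h2 h2' hgv)
      _ = 4 * (ε / 4) := by ring
      _ = ε := ENNReal.mul_div_cancel (by simp) (by simp)

theorem MemFormDomain.smul (hΩ : volume Ω ≠ ⊤) (c : ℂ) {u : L2 Ω} (hu : MemFormDomain Ω u) :
    MemFormDomain Ω (c • u) := by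
  by_cases hc : c = 0
  · simpa [hc] using memFormDomain_zero
  have h0 : ‖c‖ₑ ^ 2 ≠ 0 := by simp [hc]
  have ht : ‖c‖ₑ ^ 2 ≠ ⊤ := by simp
  refine ⟨?_, fun ε hε => ?_⟩
  · rw [starNormSq_smul hΩ]
    exact ENNReal.mul_lt_top ht.lt_top hu.1
  · obtain ⟨f, hf, hfu⟩ := hu.2 (ε / ‖c‖ₑ ^ 2) (ENNReal.div_pos hε.ne' ht)
    refine ⟨c • f, hf.smul c, ?_⟩
    rw [← smul_sub, starNormSq_smul hΩ, mul_comm]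
    exact (ENNReal.lt_div_iff_mul_lt (Or.inl h0) (Or.inl ht)).1 hfu

theorem integrableOn_log_norm (hd : 1 ≤ d) :
    IntegrableOn (fun ξ : Space d => Real.log ‖ξ‖) (Metric.ball 0 1) := by
  have : Nonempty (Fin d) := ⟨⟨0, hd⟩⟩
  rw [integrableOn_fun_norm_addHaar volume (f := Real.log)]
  have h1 : IntegrableOn Real.log (Set.Ioo (0 : ℝ) 1) := by
    have := (intervalIntegral.intervalIntegrable_log' (a := 0) (b := 1)).1
    exact this.mono_set Set.Ioo_subset_Ioc_self
  simp only [smul_eq_mul]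
  refine h1.bdd_mul (c := 1) (by fun_prop) ?_
  filter_upwards [ae_restrict_mem measurableSet_Ioo] with y hy
  rw [norm_pow, Real.norm_of_nonneg hy.1.le]
  exact pow_le_one₀ hy.1.le hy.2.le

theorem integrable_weight_mul_sq (hΩ : volume Ω ≠ ⊤) {u : L2 Ω} (hu : starNormSq Ω u < ⊤) :
    Integrable fun ξ : Space d => Real.log (Real.exp 1 + ‖ξ‖) * ‖fourierTr Ω u ξ‖ ^ 2 := by
  refine ⟨(continuous_weight.mul ((continuous_fourier hΩ u).norm.pow 2)).aestronglyMeasurable, ?_⟩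
  refine lt_of_le_of_lt (le_of_eq (lintegral_congr fun ξ => ?_)) hu
  rw [enorm_mul, enorm_pow, enorm_norm,
    Real.enorm_of_nonneg (zero_le_one.trans (one_le_weight ξ))]

/-- The integral defining `(u, v)_log` converges absolutely on the form domain. -/
theorem integrable_logForm (hd : 1 ≤ d) (hΩ : volume Ω ≠ ⊤) {u v : L2 Ω}
    (hu : MemFormDomain Ω u) (hv : MemFormDomain Ω v) :
    Integrable fun ξ : Space d =>
      (Real.log ‖ξ‖ : ℂ) * (fourierTr Ω u ξ * conj (fourierTr Ω v ξ)) := by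
  set A := ∫ x in Ω, ‖u x‖
  set B := ∫ x in Ω, ‖v x‖
  have hA : 0 ≤ A := integral_nonneg fun _ => norm_nonneg _
  have hB : 0 ≤ B := integral_nonneg fun _ => norm_nonneg _
  have hI : Integrable ((Metric.ball (0 : Space d) 1).indicator
      fun ξ => |Real.log ‖ξ‖| * (A * B)) :=
    IntegrableOn.integrable_indicator ((integrableOn_log_norm hd).abs.mul_const (A * B))
      measurableSet_ball
  refine (((integrable_weight_mul_sq hΩ hu.1).add (integrable_weight_mul_sq hΩ hv.1)).add
    hI).mono' ?_ (Filter.Eventually.of_forall fun ξ => ?_)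
  · refine Measurable.aestronglyMeasurable ?_
    have h1 := (continuous_fourier hΩ u).measurable
    have h2 := (continuous_fourier hΩ v).measurable
    have h3 : Measurable fun ξ : Space d => (Real.log ‖ξ‖ : ℂ) :=
      Complex.measurable_ofReal.comp (Real.measurable_log.comp measurable_norm)
    exact h3.mul (h1.mul (Complex.continuous_conj.measurable.comp h2))
  · simp only [norm_mul, Complex.norm_real, RCLike.norm_conj, Pi.add_apply, Real.norm_eq_abs]
    have ha := norm_fourier_le u ξ
    have hb := norm_fourier_le v ξ
    have hw := one_le_weight ξ
    have ha0 := norm_nonneg (fourierTr Ω u ξ)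
    have hb0 := norm_nonneg (fourierTr Ω v ξ)
    by_cases hξ : ξ ∈ Metric.ball (0 : Space d) 1
    · rw [Set.indicator_of_mem hξ]
      have h : |Real.log ‖ξ‖| * (‖fourierTr Ω u ξ‖ * ‖fourierTr Ω v ξ‖)
          ≤ |Real.log ‖ξ‖| * (A * B) := by gcongr
      have h1 : 0 ≤ Real.log (Real.exp 1 + ‖ξ‖) * ‖fourierTr Ω u ξ‖ ^ 2 := by positivity
      have h2 : 0 ≤ Real.log (Real.exp 1 + ‖ξ‖) * ‖fourierTr Ω v ξ‖ ^ 2 := by positivity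
      linarith
    · rw [Set.indicator_of_notMem hξ, add_zero]
      have h1 : 1 ≤ ‖ξ‖ := by simpa using hξ
      have hl : |Real.log ‖ξ‖| ≤ Real.log (Real.exp 1 + ‖ξ‖) := by
        rw [abs_of_nonneg (Real.log_nonneg h1)]
        exact Real.log_le_log (by linarith) (by linarith [Real.exp_pos 1])
      calc |Real.log ‖ξ‖| * (‖fourierTr Ω u ξ‖ * ‖fourierTr Ω v ξ‖)
          ≤ Real.log (Real.exp 1 + ‖ξ‖) * (‖fourierTr Ω u ξ‖ * ‖fourierTr Ω v ξ‖) := by gcongr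
        _ ≤ Real.log (Real.exp 1 + ‖ξ‖) * (‖fourierTr Ω u ξ‖ ^ 2 + ‖fourierTr Ω v ξ‖ ^ 2) := by
            gcongr
            nlinarith [sq_nonneg (‖fourierTr Ω u ξ‖ - ‖fourierTr Ω v ξ‖)]
        _ = _ := by ring

theorem logForm_add (hd : 1 ≤ d) (hΩ : volume Ω ≠ ⊤) {u v w : L2 Ω}
    (hu : MemFormDomain Ω u) (hv : MemFormDomain Ω v) (hw : MemFormDomain Ω w) :
    logForm Ω (u + v) w = logForm Ω u w + logForm Ω v w := by
  unfold logForm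
  rw [← mul_add, ← integral_add (integrable_logForm hd hΩ hu hw) (integrable_logForm hd hΩ hv hw)]
  simp only [fourier_add hΩ, add_mul, mul_add]

theorem logForm_smul (c : ℂ) (u w : L2 Ω) : logForm Ω (c • u) w = c * logForm Ω u w := by
  unfold logForm
  rw [mul_left_comm c, ← integral_const_mul c]
  simp only [fourier_smul]
  congr 2
  ext ξ
  ring

/-- `∫_Ω u conj(v)` is the inner product of `L²(Ω)`. -/
theorem integral_mul_conj_eq_inner (u v : L2 Ω) :
    ∫ x in Ω, u x * conj (v x) = inner ℂ v u := by
  rw [L2.inner_def]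
  simp [RCLike.inner_apply]

end helpers

/-- The space of weak solutions of `𝓗 u = μ u` in `Ω`, `u = 0` on `ℝ^d ∖ Ω`. It is nonzero
if and only if `μ` is an eigenvalue. -/
def eigenspace {d : ℕ} (hd : 1 ≤ d) (Ω : Set (Space d)) (hΩ : volume Ω ≠ ⊤) (μ : ℝ) :
    Submodule ℂ (L2 Ω) where
  carrier := {u | IsWeakSolution Ω μ u}
  zero_mem' := by
    refine ⟨memFormDomain_zero, fun v _ => ?_⟩
    have h := logForm_smul (0 : ℂ) (0 : L2 Ω) v
    rw [integral_mul_conj_eq_inner, inner_zero_right, mul_zero]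
    simpa using h
  add_mem' := by
    rintro u v ⟨hu, hu'⟩ ⟨hv, hv'⟩
    refine ⟨hu.add hΩ hv, fun w hw => ?_⟩
    rw [logForm_add hd hΩ hu hv hw, hu' w hw, hv' w hw]
    simp only [integral_mul_conj_eq_inner, inner_add_right]
    ring
  smul_mem' := by
    rintro c u ⟨hu, hu'⟩
    refine ⟨hu.smul hΩ c, fun w hw => ?_⟩
    rw [logForm_smul, hu' w hw]
    simp only [integral_mul_conj_eq_inner, inner_smul_right]
    ring

/-- The multiplicity of `μ` as an eigenvalue, i.e. the (possibly infinite) dimension of the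
eigenspace; it is `0` if `μ` is not an eigenvalue. -/
def eigenMultiplicity {d : ℕ} (hd : 1 ≤ d) (Ω : Set (Space d)) (hΩ : volume Ω ≠ ⊤) (μ : ℝ) : ℕ∞ :=
  Cardinal.toENat (Module.rank ℂ (eigenspace hd Ω hΩ μ))

/-- The Riesz mean `∑ₖ (t - λₖ)₊`, the sum over all eigenvalues `λₖ`, each one repeated according
to its multiplicity. It is written as a sum over all real numbers `μ`, weighted with the
multiplicity of `μ`, and takes values in `[0, ∞]`. -/
def rieszMean {d : ℕ} (hd : 1 ≤ d) (Ω : Set (Space d)) (hΩ : volume Ω ≠ ⊤) (t : ℝ) : ℝ≥0∞ :=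
  ∑' μ : ℝ, (eigenMultiplicity hd Ω hΩ μ : ℝ≥0∞) * ENNReal.ofReal (t - μ)

end

end LogLaplacian

namespace LogLaplacian

/-! This is the Berezin–Li–Yau argument. If `u` is an eigenfunction with `‖u‖ = 1` and eigenvalue
`μ`, then `(2π)^{-d} |û|² dξ` is a probability measure by Plancherel, and testing the weak equation
with `u` itself shows that `μ` is the mean of `log |ξ|` under it. Hence `(t - μ)₊` is at most the
mean of `(t - log |ξ|)₊` (`IsWeakSolution.sub_le`).

Over an orthonormal family of eigenfunctions, `∑ |û_i(ξ)|² ≤ |Ω|` at every frequency: `û_i(ξ)` is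
the inner product of `u_i` with a plane wave, whose squared norm in `L²(Ω)` is `|Ω|`
(`sum_norm_sq_fourierTr_le`). What remains is the integral of `(t - log |ξ|)₊`, bounded by `e^{dt}
|B_d| / d` (`lintegral_sub_log_norm_le`).

Neither discreteness of the spectrum nor completeness of the eigenfunctions is needed: the bound is
uniform over finite orthonormal families, and the Riesz mean is a supremum of such finite sums. -/

open FourierTransform SchwartzMap Set

/-! ### Plancherel's theorem -/

/-- For integrable and square integrable functions, the Fourier integral agrees almost everywhere
with the Fourier transform on `L²`. -/
theorem fourier_toLp_ae_eq {d : ℕ} {f : Space d → ℂ} (hf : Integrable f) (hf2 : MemLp f 2) :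
    𝓕 f =ᵐ[volume] (𝓕 (hf2.toLp f) : Lp ℂ 2 (volume : Measure (Space d))) := by
  have hcont : Continuous (𝓕 f) := VectorFourier.fourierIntegral_continuous
    Real.continuous_fourierChar (by exact continuous_inner) hf
  -- Compare both sides against test functions `g`: the transform moves onto `g`, by Fubini for the
  -- integral and by duality of tempered distributions for the `L²` transform.
  refine ae_eq_of_integral_contDiff_smul_eq hcont.locallyIntegrable
    ((Lp.memLp _).locallyIntegrable (by norm_num)) fun g hg hgc => ?_
  have hgc' : HasCompactSupport fun x => (g x : ℂ) := hgc.comp_left Complex.ofReal_zero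
  let G : 𝓢(Space d, ℂ) := hgc'.toSchwartzMap (Complex.ofRealCLM.contDiff.comp hg)
  have hG : ∀ x, G x = g x := fun x => rfl
  have h1 : ∫ ξ, 𝓕 (G : Space d → ℂ) ξ • f ξ = ∫ x, G x • 𝓕 f x := by
    have := VectorFourier.integral_fourierIntegral_smul_eq_flip (L := innerₗ (Space d))
      (μ := volume) (ν := volume) Real.continuous_fourierChar continuous_inner G.integrable hf
    rw [flip_innerₗ] at this
    exact this
  have h2 := congrArg (fun T => T G) (Lp.fourier_toTemperedDistribution_eq (hf2.toLp f))
  simp only [TemperedDistribution.fourier_apply, Lp.toTemperedDistribution_apply] at h2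
  have h3 : ∫ ξ, 𝓕 G ξ • (hf2.toLp f) ξ = ∫ ξ, 𝓕 (G : Space d → ℂ) ξ • f ξ := by
    refine integral_congr_ae ?_
    filter_upwards [hf2.coeFn_toLp] with x hx
    rw [hx, SchwartzMap.fourier_coe]
  rw [h3, h1] at h2
  simpa only [hG, Complex.real_smul, smul_eq_mul] using h2

theorem norm_sq_eq_integral_norm_sq {α : Type*} [MeasurableSpace α] {ν : Measure α}
    (f : Lp ℂ 2 ν) : ‖f‖ ^ 2 = ∫ x, ‖f x‖ ^ 2 ∂ν := by
  rw [← RCLike.ofReal_inj (K := ℂ), RCLike.ofReal_pow, ← inner_self_eq_norm_sq_to_K,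
    L2.inner_def, ← integral_ofReal]
  simp only [inner_self_eq_norm_sq_to_K, RCLike.ofReal_pow]

/-- Plancherel's theorem for integrable and square integrable functions. -/
theorem integral_norm_sq_fourier {d : ℕ} {f : Space d → ℂ} (hf : Integrable f) (hf2 : MemLp f 2) :
    ∫ ξ, ‖𝓕 f ξ‖ ^ 2 = ∫ x, ‖f x‖ ^ 2 := by
  have h : ‖(𝓕 (hf2.toLp f) : Lp ℂ 2 (volume : Measure (Space d)))‖ ^ 2 = ‖hf2.toLp f‖ ^ 2 := by
    rw [Lp.norm_fourier_eq]
  rw [norm_sq_eq_integral_norm_sq, norm_sq_eq_integral_norm_sq] at h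
  have h1 : ∫ ξ, ‖𝓕 f ξ‖ ^ 2 = ∫ ξ,
      ‖(𝓕 (hf2.toLp f) : Lp ℂ 2 (volume : Measure (Space d))) ξ‖ ^ 2 := by
    refine integral_congr_ae ?_
    filter_upwards [fourier_toLp_ae_eq hf hf2] with x hx
    rw [hx]
  rw [h1, h]
  refine integral_congr_ae ?_
  filter_upwards [hf2.coeFn_toLp] with x hx
  rw [hx]

variable {d : ℕ} {Ω : Set (Space d)}

/-- `𝓕` has kernel `e^{-2πi x·ξ}`, so the frequency is rescaled by `1/(2π)`; the Jacobian of this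
scaling is the factor `(2π)^d` in Plancherel's identity. -/
theorem fourierTr_eq_fourier_indicator (hΩ : MeasurableSet Ω) (u : L2 Ω) (ξ : Space d) :
    fourierTr Ω u ξ = 𝓕 (Ω.indicator u) ((2 * Real.pi)⁻¹ • ξ) := by
  rw [Real.fourier_eq', fourierTr, ← integral_indicator hΩ]
  refine integral_congr_ae (Filter.Eventually.of_forall fun x => ?_)
  by_cases hx : x ∈ Ω
  · simp only [indicator_of_mem hx, inner_smul_right, smul_eq_mul]
    congr 2
    have := Real.pi_ne_zero
    push_cast
    field_simp
  · simp [indicator_of_notMem hx]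

/-- Plancherel's theorem on `L²(Ω)`. -/
theorem integral_norm_sq_fourierTr (hΩ : MeasurableSet Ω) (hfin : volume Ω ≠ ⊤) (u : L2 Ω) :
    ∫ ξ, ‖fourierTr Ω u ξ‖ ^ 2 = (2 * Real.pi) ^ d * ‖u‖ ^ 2 := by
  simp only [fourierTr_eq_fourier_indicator hΩ]
  rw [Measure.integral_comp_smul volume (fun ξ => ‖𝓕 (Ω.indicator u) ξ‖ ^ 2),
    integral_norm_sq_fourier ((integrable_indicator_iff hΩ).2 (integrable_coe hfin u))
      ((memLp_indicator_iff_restrict hΩ).2 (Lp.memLp u)), norm_sq_eq_integral_norm_sq,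
    ← integral_indicator hΩ, finrank_euclideanSpace_fin, smul_eq_mul, inv_pow, inv_inv,
    abs_of_nonneg (by positivity)]
  congr 2
  ext x
  by_cases hx : x ∈ Ω <;> simp [hx]

/-! ### Plane waves and Bessel's inequality -/

/-- The restriction to `Ω` of the plane wave with frequency `ξ`. -/
noncomputable def planeWave (hfin : volume Ω ≠ ⊤) (ξ : Space d) : L2 Ω :=
  haveI : IsFiniteMeasure (volume.restrict Ω) := ⟨by simpa using hfin.lt_top⟩
  (MemLp.of_bound (f := fun x => Complex.exp (Complex.I * ((inner ℝ x ξ : ℝ) : ℂ)))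
    (by fun_prop : Continuous _).aestronglyMeasurable 1
    (Filter.Eventually.of_forall fun x => by rw [Complex.norm_exp]; simp)).toLp _

theorem planeWave_ae_eq (hfin : volume Ω ≠ ⊤) (ξ : Space d) :
    planeWave hfin ξ =ᵐ[volume.restrict Ω]
      fun x => Complex.exp (Complex.I * ((inner ℝ x ξ : ℝ) : ℂ)) :=
  MemLp.coeFn_toLp _

theorem norm_sq_planeWave (hfin : volume Ω ≠ ⊤) (ξ : Space d) :
    ‖planeWave hfin ξ‖ ^ 2 = volume.real Ω := by
  rw [norm_sq_eq_integral_norm_sq, integral_congr_ae (g := fun _ => (1 : ℝ))]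
  · simp
  · filter_upwards [planeWave_ae_eq hfin ξ] with x hx
    rw [hx, Complex.norm_exp]
    simp

/-- The inner product is conjugate-linear in its first slot, so `e^{i x·ξ}` there produces the
kernel `e^{-i x·ξ}`. This makes Bessel's inequality applicable at each fixed `ξ`. -/
theorem fourierTr_eq_inner (hfin : volume Ω ≠ ⊤) (u : L2 Ω) (ξ : Space d) :
    fourierTr Ω u ξ = inner ℂ (planeWave hfin ξ) u := by
  rw [← integral_mul_conj_eq_inner, fourierTr]
  refine integral_congr_ae ?_
  filter_upwards [planeWave_ae_eq hfin ξ] with x hx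
  rw [hx, ← Complex.exp_conj, mul_comm]
  simp

/-- Bessel's inequality for the plane waves. -/
theorem sum_norm_sq_fourierTr_le (hfin : volume Ω ≠ ⊤) {ι : Type*} [Fintype ι] {u : ι → L2 Ω}
    (hu : Orthonormal ℂ u) (ξ : Space d) :
    ∑ i, ‖fourierTr Ω (u i) ξ‖ ^ 2 ≤ volume.real Ω := by
  rw [← norm_sq_planeWave hfin ξ]
  simp only [fourierTr_eq_inner hfin, norm_inner_symm (planeWave hfin ξ)]
  exact hu.sum_inner_products_le (s := Finset.univ) (planeWave hfin ξ)

/-! ### The phase space integral -/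

/-- The integral of `(t - log |ξ|)₊`, computed with the layer cake formula. -/
theorem lintegral_sub_log_norm_le (hd : 1 ≤ d) (t : ℝ) :
    ∫⁻ ξ : Space d, ENNReal.ofReal (max (t - Real.log ‖ξ‖) 0) ≤
      ENNReal.ofReal (Real.exp (d * t) * volume.real (Metric.ball (0 : Space d) 1) / d) := by
  have hd0 : (0 : ℝ) < d := by exact_mod_cast hd
  have hm : Measurable fun ξ : Space d => max (t - Real.log ‖ξ‖) 0 :=
    ((Real.measurable_log.comp measurable_norm).const_sub t).max measurable_const
  have hnn : 0 ≤ᵐ[volume] fun ξ : Space d => max (t - Real.log ‖ξ‖) 0 :=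
    Filter.Eventually.of_forall fun ξ => le_max_right _ _
  rw [lintegral_eq_lintegral_meas_lt _ hnn hm.aemeasurable]
  have hint : IntegrableOn (fun s => Real.exp (-d * s)) (Ioi 0) :=
    integrableOn_exp_mul_Ioi (by linarith) 0
  calc ∫⁻ s in Ioi (0 : ℝ), volume {ξ : Space d | s < max (t - Real.log ‖ξ‖) 0}
      ≤ ∫⁻ s in Ioi (0 : ℝ), ENNReal.ofReal
          (Real.exp (d * t) * volume.real (Metric.ball (0 : Space d) 1) * Real.exp (-d * s)) := by
        refine setLIntegral_mono' measurableSet_Ioi fun s hs => ?_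
        -- Only an inclusion holds: as `Real.log 0 = 0`, the origin is missing from the left side
        -- when `s ≥ t`.
        have hsub : {ξ : Space d | s < max (t - Real.log ‖ξ‖) 0} ⊆
            Metric.ball 0 (Real.exp (t - s)) := by
          intro ξ hξ
          have h1 : s < t - Real.log ‖ξ‖ :=
            (lt_max_iff.1 hξ).resolve_right (not_lt.2 (le_of_lt hs))
          rw [mem_ball_zero_iff]
          rcases (norm_nonneg ξ).eq_or_lt with h0 | h0
          · rw [← h0]
            exact Real.exp_pos _
          · rw [← Real.log_lt_iff_lt_exp h0]
            linarith
        refine (measure_mono hsub).trans (le_of_eq ?_)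
        rw [Measure.addHaar_ball_of_pos _ _ (Real.exp_pos _), finrank_euclideanSpace_fin,
          ← ofReal_measureReal (measure_ball_lt_top.ne), ← ENNReal.ofReal_mul (by positivity),
          ← Real.exp_nat_mul, mul_right_comm, ← Real.exp_add]
        congr 3
        ring
    -- The factor `1/d` is `∫₀^∞ e^{-ds} ds`.
    _ = _ := by
        rw [← ofReal_integral_eq_lintegral_ofReal (hint.const_mul _)
          (Filter.Eventually.of_forall fun s => by positivity), integral_const_mul,
          integral_exp_mul_Ioi (by linarith)]
        congr 1
        simp
        field_simp

theorem integrable_sub_log_norm (hd : 1 ≤ d) (t : ℝ) :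
    Integrable fun ξ : Space d => max (t - Real.log ‖ξ‖) 0 := by
  have hm : Measurable fun ξ : Space d => max (t - Real.log ‖ξ‖) 0 :=
    ((Real.measurable_log.comp measurable_norm).const_sub t).max measurable_const
  rw [← lintegral_ofReal_ne_top_iff_integrable hm.aestronglyMeasurable
    (Filter.Eventually.of_forall fun ξ => le_max_right _ _)]
  exact ((lintegral_sub_log_norm_le hd t).trans_lt ENNReal.ofReal_lt_top).ne

theorem integral_sub_log_norm_le (hd : 1 ≤ d) (t : ℝ) :
    ∫ ξ : Space d, max (t - Real.log ‖ξ‖) 0 ≤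
      Real.exp (d * t) * volume.real (Metric.ball (0 : Space d) 1) / d := by
  rw [← ENNReal.ofReal_le_ofReal_iff (by positivity), ofReal_integral_eq_lintegral_ofReal
    (integrable_sub_log_norm hd t) (Filter.Eventually.of_forall fun ξ => le_max_right _ _)]
  exact lintegral_sub_log_norm_le hd t

/-! ### The quadratic form on eigenfunctions -/

/-- The symbol `log |ξ|` is real, so the form is Hermitian; orthogonality of eigenspaces rests on
this. -/
theorem logForm_conj_symm (u v : L2 Ω) : conj (logForm Ω v u) = logForm Ω u v := by
  unfold logForm
  rw [map_mul, Complex.conj_ofReal, ← integral_conj]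
  congr 2
  ext ξ
  simp only [map_mul, Complex.conj_ofReal, Complex.conj_conj]
  ring

/-- Weak solutions for distinct eigenvalues are orthogonal. -/
theorem IsWeakSolution.inner_eq_zero {μ ν : ℝ} (hμν : μ ≠ ν) {u v : L2 Ω}
    (hu : IsWeakSolution Ω μ u) (hv : IsWeakSolution Ω ν v) : inner ℂ u v = 0 := by
  have h1 := hu.2 v hv.1
  have h2 := hv.2 u hu.1
  rw [integral_mul_conj_eq_inner] at h1 h2
  rw [← logForm_conj_symm, h1, map_mul, Complex.conj_ofReal, inner_conj_symm] at h2
  have h3 : ((μ : ℂ) - ν) * inner ℂ u v = 0 := by rw [sub_mul, h2, sub_self]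
  exact (mul_eq_zero.1 h3).resolve_left (sub_ne_zero.2 (by exact_mod_cast hμν))

theorem integrable_norm_sq_fourierTr (hfin : volume Ω ≠ ⊤) {u : L2 Ω} (hu : MemFormDomain Ω u) :
    Integrable fun ξ : Space d => ‖fourierTr Ω u ξ‖ ^ 2 := by
  refine (integrable_weight_mul_sq hfin hu.1).mono'
    ((continuous_fourier hfin u).norm.pow 2).aestronglyMeasurable
    (Filter.Eventually.of_forall fun ξ => ?_)
  rw [Real.norm_of_nonneg (by positivity)]
  exact le_mul_of_one_le_left (by positivity) (one_le_weight ξ)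

theorem integrable_log_mul_norm_sq_fourierTr (hd : 1 ≤ d) (hfin : volume Ω ≠ ⊤) {u : L2 Ω}
    (hu : MemFormDomain Ω u) :
    Integrable fun ξ : Space d => Real.log ‖ξ‖ * ‖fourierTr Ω u ξ‖ ^ 2 := by
  have h := (integrable_logForm hd hfin hu hu).re
  refine h.congr (Filter.Eventually.of_forall fun ξ => ?_)
  simp only [Complex.mul_conj, Complex.normSq_eq_norm_sq, ← Complex.ofReal_mul]
  exact Complex.ofReal_re _

theorem logForm_self (u : L2 Ω) :
    logForm Ω u u =
      ((((2 * Real.pi) ^ d)⁻¹ * ∫ ξ : Space d, Real.log ‖ξ‖ * ‖fourierTr Ω u ξ‖ ^ 2 : ℝ) : ℂ) := by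
  unfold logForm
  rw [Complex.ofReal_mul, ← integral_complex_ofReal]
  simp only [Complex.mul_conj, Complex.normSq_eq_norm_sq, ← Complex.ofReal_mul]

theorem IsWeakSolution.eigenvalue_eq {μ : ℝ} {u : L2 Ω} (hu : IsWeakSolution Ω μ u)
    (hnorm : ‖u‖ = 1) :
    μ = ((2 * Real.pi) ^ d)⁻¹ * ∫ ξ : Space d, Real.log ‖ξ‖ * ‖fourierTr Ω u ξ‖ ^ 2 := by
  have h := hu.2 u hu.1
  rw [integral_mul_conj_eq_inner, inner_self_eq_norm_sq_to_K, hnorm, logForm_self] at h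
  simp only [RCLike.ofReal_one, one_pow, mul_one] at h
  exact_mod_cast h.symm

/-- Membership in the form domain is not required: `û` is bounded by the `L¹` norm of `u`, and `(t -
log |ξ|)₊` is integrable on its own. -/
theorem integrable_sub_log_norm_mul_norm_sq_fourierTr (hd : 1 ≤ d) (hfin : volume Ω ≠ ⊤)
    (u : L2 Ω) (t : ℝ) :
    Integrable fun ξ : Space d => max (t - Real.log ‖ξ‖) 0 * ‖fourierTr Ω u ξ‖ ^ 2 := by
  refine (integrable_sub_log_norm hd t).mul_bdd (c := (∫ x in Ω, ‖u x‖) ^ 2)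
    ((continuous_fourier hfin u).norm.pow 2).aestronglyMeasurable
    (Filter.Eventually.of_forall fun ξ => ?_)
  rw [norm_pow, norm_norm]
  exact pow_le_pow_left₀ (norm_nonneg _) (norm_fourier_le u ξ) 2

/-- For a normalized eigenfunction with eigenvalue `μ`, the positive part of `t - μ` is bounded by
the phase space average of the positive part of `t - log |ξ|`. -/
theorem IsWeakSolution.sub_le (hd : 1 ≤ d) (hΩ : MeasurableSet Ω) (hfin : volume Ω ≠ ⊤) {μ : ℝ}
    {u : L2 Ω} (hu : IsWeakSolution Ω μ u) (hnorm : ‖u‖ = 1) (t : ℝ) :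
    max (t - μ) 0 ≤ ((2 * Real.pi) ^ d)⁻¹ *
      ∫ ξ : Space d, max (t - Real.log ‖ξ‖) 0 * ‖fourierTr Ω u ξ‖ ^ 2 := by
  refine max_le ?_ (mul_nonneg (by positivity) (integral_nonneg fun ξ => by positivity))
  -- Plancherel and `‖u‖ = 1` turn the constant `t` into its own average.
  have h1 : t = ((2 * Real.pi) ^ d)⁻¹ * ∫ ξ, t * ‖fourierTr Ω u ξ‖ ^ 2 := by
    rw [integral_const_mul, integral_norm_sq_fourierTr hΩ hfin, hnorm]
    field_simp
  have hi1 := (integrable_norm_sq_fourierTr hfin hu.1).const_mul t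
  have hi2 := integrable_log_mul_norm_sq_fourierTr hd hfin hu.1
  calc t - μ = ((2 * Real.pi) ^ d)⁻¹ * ∫ ξ : Space d,
        (t * ‖fourierTr Ω u ξ‖ ^ 2 - Real.log ‖ξ‖ * ‖fourierTr Ω u ξ‖ ^ 2) := by
        rw [integral_sub hi1 hi2, mul_sub, ← h1, ← hu.eigenvalue_eq hnorm]
    _ ≤ _ := by
        gcongr ?_ * ?_
        refine integral_mono (hi1.sub hi2)
          (integrable_sub_log_norm_mul_norm_sq_fourierTr hd hfin u t) fun ξ => ?_
        simp only [← sub_mul]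
        gcongr
        exact le_max_left _ _

/-- The Berezin–Li–Yau bound for a finite orthonormal family of eigenfunctions. -/
theorem sum_sub_le (hd : 1 ≤ d) (hΩ : MeasurableSet Ω) (hfin : volume Ω ≠ ⊤) {ι : Type*}
    [Fintype ι] {u : ι → L2 Ω} (hu : Orthonormal ℂ u) {μ : ι → ℝ}
    (hw : ∀ i, IsWeakSolution Ω (μ i) (u i)) (t : ℝ) :
    ∑ i, max (t - μ i) 0 ≤ ((2 * Real.pi) ^ d)⁻¹ * volume.real Ω * Real.exp (d * t) *
      volume.real (Metric.ball (0 : Space d) 1) / d := by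
  have hi := fun i => integrable_sub_log_norm_mul_norm_sq_fourierTr hd hfin (u i) t
  calc ∑ i, max (t - μ i) 0
      ≤ ∑ i, ((2 * Real.pi) ^ d)⁻¹ *
          ∫ ξ : Space d, max (t - Real.log ‖ξ‖) 0 * ‖fourierTr Ω (u i) ξ‖ ^ 2 :=
        Finset.sum_le_sum fun i _ => (hw i).sub_le hd hΩ hfin (hu.1 i) t
    _ = ((2 * Real.pi) ^ d)⁻¹ * ∫ ξ : Space d,
          max (t - Real.log ‖ξ‖) 0 * ∑ i, ‖fourierTr Ω (u i) ξ‖ ^ 2 := by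
        rw [← Finset.mul_sum, ← integral_finsetSum _ fun i _ => hi i]
        simp only [Finset.mul_sum]
    _ ≤ ((2 * Real.pi) ^ d)⁻¹ * ∫ ξ : Space d, max (t - Real.log ‖ξ‖) 0 * volume.real Ω := by
        gcongr ?_ * ?_
        refine integral_mono ?_ ((integrable_sub_log_norm hd t).mul_const _) fun ξ => ?_
        · simp only [Finset.mul_sum]
          exact integrable_finsetSum _ fun i _ => hi i
        · exact mul_le_mul_of_nonneg_left (sum_norm_sq_fourierTr_le hfin hu ξ) (le_max_right _ _)
    _ ≤ ((2 * Real.pi) ^ d)⁻¹ *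
          (Real.exp (d * t) * volume.real (Metric.ball (0 : Space d) 1) / d * volume.real Ω) := by
        rw [integral_mul_const]
        gcongr
        exact integral_sub_log_norm_le hd t
    _ = _ := by ring

/-! ### Multiplicities and passage to the full sum -/

/-- A submodule of rank at least `n` contains an orthonormal family of `n` vectors. -/
theorem exists_orthonormal_of_le_rank {E : Type*} [NormedAddCommGroup E] [InnerProductSpace ℂ E]
    (W : Submodule ℂ E) {n : ℕ} (hn : (n : Cardinal) ≤ Module.rank ℂ W) :
    ∃ v : Fin n → E, Orthonormal ℂ v ∧ ∀ i, v i ∈ W := by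
  obtain ⟨f, hf⟩ := exists_linearIndependent_of_le_rank hn
  -- Gram–Schmidt is run inside `W`, so membership is automatic; the isometric inclusion transports
  -- orthonormality to `E`.
  refine ⟨fun i => (InnerProductSpace.gramSchmidtNormed ℂ f i : W), ?_,
    fun i => Subtype.property _⟩
  exact (InnerProductSpace.gramSchmidtNormed_orthonormal hf).comp_linearIsometry W.subtypeₗᵢ

/-- The bound for finitely many eigenvalues, each counted at most as often as its multiplicity. -/
theorem sum_mul_sub_le (hd : 1 ≤ d) (hΩ : MeasurableSet Ω) (hfin : volume Ω ≠ ⊤) (s : Finset ℝ)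
    (n : ℝ → ℕ) (hn : ∀ μ, (n μ : ℕ∞) ≤ eigenMultiplicity hd Ω hfin μ) (t : ℝ) :
    ∑ μ ∈ s, (n μ : ℝ) * max (t - μ) 0 ≤ ((2 * Real.pi) ^ d)⁻¹ * volume.real Ω *
      Real.exp (d * t) * volume.real (Metric.ball (0 : Space d) 1) / d := by
  have hn' : ∀ μ, (n μ : Cardinal) ≤ Module.rank ℂ (eigenspace hd Ω hfin μ) := fun μ => by
    simpa [eigenMultiplicity] using hn μ
  choose v hv hvm using fun μ => exists_orthonormal_of_le_rank _ (hn' μ)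
  -- Within one eigenvalue the vectors are orthonormal by choice; across distinct eigenvalues they
  -- are orthogonal by symmetry of the form.
  have ho : Orthonormal ℂ fun p : Σ μ : s, Fin (n μ) => v p.1 p.2 := by
    refine ⟨fun p => (hv _).1 _, ?_⟩
    rintro ⟨μ, i⟩ ⟨ν, j⟩ hne
    by_cases h : μ = ν
    · subst h
      exact (hv _).2 fun hij => hne (congrArg (Sigma.mk μ) hij)
    · exact (hvm μ i : IsWeakSolution Ω μ _).inner_eq_zero (fun h' => h (Subtype.ext h'))
        (hvm ν j)
  refine le_trans (le_of_eq ?_)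
    (sum_sub_le hd hΩ hfin ho (μ := fun p => (p.1 : ℝ)) (fun p => hvm _ _) t)
  rw [Fintype.sum_sigma, ← Finset.sum_coe_sort s]
  simp

/-- Exhausts a possibly infinite multiplicity by finite counts. Truncating before `toNat` avoids its
default value `0` at `⊤`. -/
theorem _root_.ENat.toENNReal_eq_iSup_min (m : ℕ∞) :
    (m : ℝ≥0∞) = ⨆ k : ℕ, (((min m k).toNat : ℕ) : ℝ≥0∞) := by
  induction m using ENat.recTopCoe with
  | top => simp [ENNReal.iSup_natCast]
  | coe m =>
    refine le_antisymm (le_iSup_of_le m (by simp)) (iSup_le fun k => ?_)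
    have h : (min (m : ℕ∞) k).toNat ≤ m :=
      ENat.toNat_le_of_le_natCast (min_le_left _ _)
    simpa using h

end LogLaplacian

theorem mainTheorem1 (d : ℕ) (hd : 1 ≤ d) (Ω : Set (LogLaplacian.Space d)) (hΩ : IsOpen Ω)
    (hfin : MeasureTheory.volume Ω ≠ ⊤) (t : ℝ) :
    LogLaplacian.rieszMean hd Ω hfin t ≤
      ENNReal.ofReal (((2 * Real.pi) ^ d)⁻¹ * MeasureTheory.volume.real Ω * Real.exp (d * t) *
        MeasureTheory.volume.real (Metric.ball (0 : LogLaplacian.Space d) 1) / d) := by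
  rw [LogLaplacian.rieszMean, ENNReal.tsum_eq_iSup_sum]
  refine iSup_le fun s => ?_
  simp only [ENat.toENNReal_eq_iSup_min, ENNReal.iSup_mul]
  -- The truncated multiplicities increase with `k`, so a single level `k` serves all eigenvalues in
  -- `s` and the supremum leaves the finite sum.
  rw [ENNReal.finsetSum_iSup_of_monotone]
  · refine iSup_le fun k => ?_
    have h := LogLaplacian.sum_mul_sub_le hd hΩ.measurableSet hfin s
      (fun μ => (min (LogLaplacian.eigenMultiplicity hd Ω hfin μ) k).toNat)
      (fun μ => (ENat.natCast_toNat_le_self _).trans (min_le_left _ _)) t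
    refine le_trans (le_of_eq ?_) (ENNReal.ofReal_le_ofReal h)
    rw [ENNReal.ofReal_sum_of_nonneg fun μ _ => by positivity]
    refine Finset.sum_congr rfl fun μ _ => ?_
    rw [ENNReal.ofReal_mul (by positivity), ENNReal.ofReal_natCast]
    simp
  · intro μ i j hij
    dsimp only
    gcongr
    simp
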